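/- Let $k\ge 0$ and $p,q\ge 1$ be integers with $p/q>2$. All graphs are finite and simple. A $k$-tree is a graph obtained from a complete graph of order $k+1$ by successively adding vertices whose neighborhood, at the time of addition, is a clique of order $k$. A rooted partial $k$-tree is a graph $G$ with $k+1$ distinguished vertices $v_1,\ldots,v_{k+1}$ (its root) such that some $k$-tree $T$ contains $G$ as a subgraph and $v_1,\ldots,v_{k+1}$ form a clique of order $k+1$ in $T$. A $(p,q)$-coloring of $G$ is a map $c:V(G)\to\{0,\ldots,p-1\}$ such that $q\le|c(u)-c(v)|\le p-q$ for any two adjacent vertices $u,v$. Let $\mathcal F(G)$ be the set of all $(a_1,\ldots,a_{k+1})\in\{0,\ldots,p-1\}^{k+1}$ for which $G$ has a $(p,q)$-coloring $c$ with $c(v_i)=a_i$ for all $i$. The type of $G$ is the $(k+1)\times(k+1)$ matrix $M$ whose entry $M_{ij}\in\{0,1,2,\ldots\}\cup\{\infty\}$ is the distance between $v_i$ and $v_j$ in $G$ ($\infty$ if there is no path between them). Write $M\preceq M'$ if $M_{ij}\le M'_{ij}$ for all $i,j$, and $M_{ij}$ and $M'_{ij}$ have the same parity whenever both are finite. Then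 there exist a finite number $m$ and bipartite rooted partial $k$-trees $G^1,\ldots,G^m$ with types $M^1,\ldots,M^m$ such that for every bipartite rooted partial $k$-tree $G$ with type $M$ there exists $i\in\{1,\ldots,m\}$ such that $\mathcal F(G^i)\subseteq\mathcal F(G)$ and $M\preceq M^i$. -/

import Mathlib

/-- `SpansKTree k G s`: the subgraph of `G` induced by the finite vertex set `s` is a `k`-tree,
i.e. it arises from a complete graph of order `k + 1` by successively adding vertices `v`
whose neighbourhood `t`, among the vertices already present, is a clique of order `k`. -/
inductive SpansKTree (k : ℕ) {W : Type*} (G : SimpleGraph W) : Finset W → Prop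
  | complete (s : Finset W) (hs : G.IsNClique (k + 1) s) : SpansKTree k G s
  | addVertex (s : Finset W) (v : W) (hv : v ∉ s) (t : Finset W) (hts : t ⊆ s)
      (ht : G.IsNClique k t) (hadj : ∀ u ∈ s, G.Adj v u ↔ u ∈ t)
      (hs : SpansKTree k G s) : SpansKTree k G (Finset.cons v s hv)

/-- A finite graph `G` is a `k`-tree. -/
def IsKTree (k : ℕ) {W : Type*} [Fintype W] (G : SimpleGraph W) : Prop :=
  SpansKTree k G Finset.univ

/-- A rooted partial `k`-tree with vertex set `V`: a graph together with `k + 1` distinguished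
vertices (the root) such that some `k`-tree `T` contains the graph as a (not necessarily spanning
or induced) subgraph and the distinguished vertices form a clique of order `k + 1` in `T`.
In particular `V` is finite, the graph is a partial `k`-tree, and the `k + 1` distinguished
vertices are distinct. -/
structure RootedPartialKTree (k : ℕ) (V : Type*) where
  /-- the underlying graph -/
  graph : SimpleGraph V
  /-- the distinguished vertices -/
  root : Fin (k + 1) → V
  /-- the `k`-tree containing the graph, in which the root is a clique -/
  exists_kTree : ∃ (n : ℕ) (T : SimpleGraph (Fin n)) (f : SimpleGraph.Copy graph T),
    IsKTree k T ∧ ∀ i j, i ≠ j → T.Adj (f (root i)) (f (root j))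

/-- `c` is a `(p,q)`-coloring of `G`: the colors are `0, …, p - 1`, and the colors of adjacent
vertices satisfy `q ≤ |c u - c v| ≤ p - q`. -/
def IsCircularColoring (p q : ℕ) {V : Type*} (G : SimpleGraph V) (c : V → Fin p) : Prop :=
  ∀ u v, G.Adj u v →
    (q : ℤ) ≤ |((c u : ℕ) : ℤ) - ((c v : ℕ) : ℤ)| ∧
      |((c u : ℕ) : ℤ) - ((c v : ℕ) : ℤ)| ≤ (p : ℤ) - (q : ℤ)

/-- The set of `p`-precolorings of the root that extend to a `(p,q)`-coloring of the whole graph.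
A precoloring is recorded as the function sending `i` to the color of the `i`-th root vertex. -/
def RootedPartialKTree.extendable {k : ℕ} {V : Type*} (G : RootedPartialKTree k V) (p q : ℕ) :
    Set (Fin (k + 1) → Fin p) :=
  {φ | ∃ c : V → Fin p, IsCircularColoring p q G.graph c ∧ ∀ i, c (G.root i) = φ i}

/-- The type of a rooted partial `k`-tree: the matrix of the distances between the root vertices,
with entry `∞` for two vertices in different components. -/
noncomputable def RootedPartialKTree.distType {k : ℕ} {V : Type*} (G : RootedPartialKTree k V) :
    Matrix (Fin (k + 1)) (Fin (k + 1)) ℕ∞ :=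
  Matrix.of fun i j => G.graph.edist (G.root i) (G.root j)

/-- Two (bipartite) types are compatible if corresponding entries that are both finite have the
same parity. -/
def TypeCompatible {ι : Type*} (M M' : Matrix ι ι ℕ∞) : Prop :=
  ∀ i j, ∀ a b : ℕ, M i j = (a : ℕ∞) → M' i j = (b : ℕ∞) → a ≡ b [MOD 2]

/-- The relation `M ⪯ M'` on (bipartite) types: compatible, and entrywise `M i j ≤ M' i j`. -/
def TypePrec {ι : Type*} (M M' : Matrix ι ι ℕ∞) : Prop :=
  TypeCompatible M M' ∧ ∀ i j, M i j ≤ M' i j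

/-! It suffices to replace each bipartite `G` by a bipartite `H` with fewer extendable precolorings
and a larger type whose finite entries are bounded in terms of `k` and `p` only
(`RootedPartialKTree.exists_bounded`). Only finitely many pairs of extendable set and type then
occur, and one representative of each pair is enough.

By pigeonhole, some bounded scale `D` has no root distance strictly between `D` and `2 * D + 4 * p +
3`, so the relation "at distance at most `D`" splits the root into clusters
(`RootedPartialKTree.exists_clusters`). Take one copy of `G` per cluster, contract in it the
connected regions far from that cluster, and let `H` be the disjoint union. Distances inside a
cluster survive; the others become infinite, which `TypePrec` allows. Contracting connected sets
preserves tree decompositions, so `H` is again a rooted partial `k`-tree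
(`RootedPartialKTree.exists_contracted_decomposition`).

A coloring of `H` yields one of `G`. Near a cluster it is kept. A contracted vertex of color `x`
unfolds into a bipartite region, on which the pair `(x, x + q)` is rotated gradually to `(0, q)` as
the distance from the cluster grows; `2 * q < p` leaves room for this. Every cluster reaches the
same final pair before the neighborhoods of two clusters meet, so the colorings fit together. -/

open Relation

/-! ### Tree decompositions and contraction -/

/-- `TreeBags 𝓑 s`: the family `𝓑` of bags is the set of bags of a tree decomposition with vertex
set `s`. Two decompositions are joined by an edge between a bag of the first and a bag of the
second, provided that these two bags contain all common vertices. -/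
inductive TreeBags {V : Type*} : Set (Set V) → Set V → Prop
  | single (X : Set V) : TreeBags {X} X
  | glue {𝓑 𝓒 : Set (Set V)} {s t X Y : Set V} (hs : TreeBags 𝓑 s) (ht : TreeBags 𝓒 t)
      (hX : X ∈ 𝓑) (hY : Y ∈ 𝓒) (hst : s ∩ t ⊆ X ∩ Y) : TreeBags (𝓑 ∪ 𝓒) (s ∪ t)

/-- `x` and `y` lie in a common bag and have the same image under `f`. -/
def BagLink {V W : Type*} (𝓑 : Set (Set V)) (f : V → W) (x y : V) : Prop :=
  f x = f y ∧ ∃ X ∈ 𝓑, x ∈ X ∧ y ∈ X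

namespace TreeBags

variable {V W : Type*}

theorem subset {𝓑 : Set (Set V)} {s : Set V} (h : TreeBags 𝓑 s) : ∀ X ∈ 𝓑, X ⊆ s := by
  induction h with
  | single X => rintro Y rfl; exact subset_rfl
  | glue hs ht hX hY hst ihs iht =>
    rintro Z (hZ | hZ)
    · exact (ihs Z hZ).trans Set.subset_union_left
    · exact (iht Z hZ).trans Set.subset_union_right

theorem preimage {𝓑 : Set (Set V)} {s : Set V} (h : TreeBags 𝓑 s) (f : W → V) :
    TreeBags ((f ⁻¹' ·) '' 𝓑) (f ⁻¹' s) := by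
  induction h with
  | single X => rw [Set.image_singleton]; exact single _
  | @glue 𝓑 𝓒 s t X Y hs ht hX hY hst ihs iht =>
    rw [Set.image_union, Set.preimage_union]
    exact glue ihs iht (Set.mem_image_of_mem _ hX) (Set.mem_image_of_mem _ hY)
      fun x hx => hst hx

/-- A chain can leave `s` only through `s ∩ t ⊆ X ∩ Y`. An excursion into `t` is remembered by its
exit vertex `e` alone: since `f` is constant along the chain, `e` can be linked inside the bag `X`
directly to the point of return. -/
theorem reflTransGen_bagLink_of_union {𝓑 𝓒 : Set (Set V)} {s t X Y : Set V} (f : V → W)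
    (h𝓑 : ∀ Z ∈ 𝓑, Z ⊆ s) (h𝓒 : ∀ Z ∈ 𝓒, Z ⊆ t) (hX : X ∈ 𝓑) (hst : s ∩ t ⊆ X ∩ Y)
    {x y : V} (hx : x ∈ s) (h : ReflTransGen (BagLink (𝓑 ∪ 𝓒) f) x y) :
    (y ∈ s ∧ ReflTransGen (BagLink 𝓑 f) x y) ∨
      (y ∈ t ∧ ∃ e ∈ X ∩ Y, ReflTransGen (BagLink 𝓑 f) x e ∧ f e = f y) := by
  induction h with
  | refl => exact Or.inl ⟨hx, .refl⟩
  | @tail y z _ hyz ih =>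
    obtain ⟨hf, Z, hZ | hZ, hyZ, hzZ⟩ := hyz
    · left
      refine ⟨h𝓑 Z hZ hzZ, ?_⟩
      rcases ih with ⟨_, hxy⟩ | ⟨hyt, e, he, hxe, hey⟩
      · exact hxy.tail ⟨hf, Z, hZ, hyZ, hzZ⟩
      · exact (hxe.tail ⟨hey, X, hX, he.1, (hst ⟨h𝓑 Z hZ hyZ, hyt⟩).1⟩).tail
          ⟨hf, Z, hZ, hyZ, hzZ⟩
    · right
      refine ⟨h𝓒 Z hZ hzZ, ?_⟩
      rcases ih with ⟨hys, hxy⟩ | ⟨_, e, he, hxe, hey⟩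
      · exact ⟨y, hst ⟨hys, h𝓒 Z hZ hyZ⟩, hxy, hf⟩
      · exact ⟨e, he, hxe, hey.trans hf⟩

theorem reflTransGen_bagLink_left {𝓑 𝓒 : Set (Set V)} {s t X Y : Set V} (f : V → W)
    (h𝓑 : ∀ Z ∈ 𝓑, Z ⊆ s) (h𝓒 : ∀ Z ∈ 𝓒, Z ⊆ t) (hX : X ∈ 𝓑) (hst : s ∩ t ⊆ X ∩ Y)
    {x y : V} (hx : x ∈ s) (hy : y ∈ s) (h : ReflTransGen (BagLink (𝓑 ∪ 𝓒) f) x y) :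
    ReflTransGen (BagLink 𝓑 f) x y := by
  rcases reflTransGen_bagLink_of_union f h𝓑 h𝓒 hX hst hx h with h | ⟨hyt, e, he, hxe, hey⟩
  · exact h.2
  · exact hxe.tail ⟨hey, X, hX, he.1, (hst ⟨hy, hyt⟩).1⟩

/-- Contracting connected sets of vertices turns a tree decomposition into a tree
decomposition. -/
theorem image {𝓑 : Set (Set V)} {s : Set V} (h : TreeBags 𝓑 s) (f : V → W)
    (hf : ∀ x ∈ s, ∀ y ∈ s, f x = f y → ReflTransGen (BagLink 𝓑 f) x y) :
    TreeBags ((f '' ·) '' 𝓑) (f '' s) := by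
  induction h with
  | single X => rw [Set.image_singleton]; exact single _
  | @glue 𝓑 𝓒 s t X Y hs ht hX hY hst ihs iht =>
    rw [Set.image_union, Set.image_union]
    refine glue (ihs ?_) (iht ?_) (Set.mem_image_of_mem _ hX) (Set.mem_image_of_mem _ hY) ?_
    · exact fun x hx y hy hxy => reflTransGen_bagLink_left f hs.subset ht.subset hX hst hx hy
        (hf x (Or.inl hx) y (Or.inl hy) hxy)
    · refine fun x hx y hy hxy => reflTransGen_bagLink_left (Y := X) f ht.subset hs.subset hY
        ?_ hx hy ?_
      · rw [Set.inter_comm, Set.inter_comm Y]; exact hst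
      · rw [Set.union_comm]; exact hf x (Or.inr hx) y (Or.inr hy) hxy
    · rintro _ ⟨⟨x, hx, rfl⟩, ⟨y, hy, hyx⟩⟩
      rcases reflTransGen_bagLink_of_union f hs.subset ht.subset hX hst hx
        (hf x (Or.inl hx) y (Or.inr hy) hyx.symm) with ⟨hys, _⟩ | ⟨_, e, he, _, hey⟩
      · exact ⟨⟨y, (hst ⟨hys, hy⟩).1, hyx⟩, ⟨y, (hst ⟨hys, hy⟩).2, hyx⟩⟩
      · exact ⟨⟨e, he.1, hey.trans hyx⟩, ⟨e, he.2, hey.trans hyx⟩⟩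

/-- Pairwise disjoint tree decompositions can be attached to a common bag. -/
theorem star {ι : Type*} (I : Finset ι) (X : Set V) (𝓑 : ι → Set (Set V)) (s Y : ι → Set V)
    (h : ∀ i, TreeBags (𝓑 i) (s i)) (hY : ∀ i, Y i ∈ 𝓑 i) (hX : ∀ i, X ∩ s i ⊆ Y i)
    (hs : ∀ i j, i ≠ j → Disjoint (s i) (s j)) :
    TreeBags ({X} ∪ ⋃ i ∈ I, 𝓑 i) (X ∪ ⋃ i ∈ I, s i) := by
  classical
  induction I using Finset.induction_on with
  | empty => simpa using single X
  | insert j I hj ih =>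
    have key : (X ∪ ⋃ i ∈ I, s i) ∩ s j ⊆ X ∩ Y j := by
      rintro x ⟨hx | hx, hxj⟩
      · exact ⟨hx, hX j ⟨hx, hxj⟩⟩
      · simp only [Set.mem_iUnion] at hx
        obtain ⟨i, hi, hxi⟩ := hx
        exact absurd hxj (Set.disjoint_left.1 (hs i j (by rintro rfl; exact hj hi)) hxi)
    have := glue ih (h j) (Or.inl rfl) (hY j) key
    rw [Finset.set_biUnion_insert, Finset.set_biUnion_insert, Set.union_comm (𝓑 j),
      Set.union_comm (s j), ← Set.union_assoc, ← Set.union_assoc]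
    exact this

end TreeBags

/-! ### Passing between `k`-trees and tree decompositions -/

namespace SpansKTree

variable {k : ℕ} {V : Type*} {T : SimpleGraph V}

/-- If the newest vertex `v` belongs to `C`, the rest of `C` consists of its earlier neighbors, so
`insert v t` serves. -/
theorem exists_isNClique_superset {s : Finset V} (h : SpansKTree k T s) (C : Finset V)
    (hC : T.IsClique (C : Set V)) (hCs : C ⊆ s) :
    ∃ Q, C ⊆ Q ∧ Q ⊆ s ∧ T.IsNClique (k + 1) Q := by
  classical
  induction h with
  | complete s hs => exact ⟨s, hCs, subset_rfl, hs⟩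
  | addVertex s v hv t hts ht hadj hs ih =>
    by_cases hvC : v ∈ C
    · refine ⟨insert v t, ?_, ?_, ht.insert fun b hb => (hadj b (hts hb)).2 hb⟩
      · intro u hu
        by_cases huv : u = v
        · simp [huv]
        · have hus : u ∈ s := by simpa [huv] using hCs hu
          exact Finset.mem_insert_of_mem ((hadj u hus).1 (hC hvC hu (Ne.symm huv)))
      · rw [Finset.cons_eq_insert]
        exact Finset.insert_subset_insert v hts
    · obtain ⟨Q, hCQ, hQs, hQ⟩ := ih fun u hu => by
        have := hCs hu
        rw [Finset.mem_cons] at this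
        exact this.resolve_left (by rintro rfl; exact hvC hu)
      exact ⟨Q, hCQ, hQs.trans (Finset.subset_cons hv), hQ⟩

/-- Each added vertex contributes the bag formed by it and its neighborhood `t`. The clause on
cliques is needed for the induction: it supplies the old bag containing `t` to which the new one is
glued. -/
theorem exists_treeBags {s : Finset V} (h : SpansKTree k T s) :
    ∃ 𝓑 : Set (Set V), TreeBags 𝓑 (s : Set V) ∧ (∀ X ∈ 𝓑, X.encard ≤ k + 1) ∧
      ∀ C : Finset V, T.IsClique (C : Set V) → C ⊆ s → ∃ X ∈ 𝓑, (C : Set V) ⊆ X := by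
  classical
  induction h with
  | complete s hs =>
    refine ⟨{(s : Set V)}, .single _, ?_, ?_⟩
    · rintro _ rfl
      rw [Set.encard_coe_eq_coe_finsetCard, hs.card_eq]; norm_cast
    · exact fun C _ hCs => ⟨_, rfl, Finset.coe_subset.2 hCs⟩
  | addVertex s v hv t hts ht hadj hs ih =>
    obtain ⟨𝓑, h𝓑, hcard, hcl⟩ := ih
    obtain ⟨X, hX, htX⟩ := hcl t ht.isClique hts
    have hvt : v ∉ t := fun h => hv (hts h)
    refine ⟨𝓑 ∪ {((insert v t : Finset V) : Set V)}, ?_, ?_, ?_⟩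
    · have := TreeBags.glue h𝓑 (.single ((insert v t : Finset V) : Set V)) hX rfl (by
        rintro x ⟨hxs, hx⟩
        refine ⟨?_, hx⟩
        rcases Finset.mem_insert.1 hx with rfl | hx
        · exact absurd hxs hv
        · exact htX hx)
      convert this using 1
      ext x
      simp only [Finset.coe_cons, Set.mem_insert_iff, Finset.mem_coe, Finset.coe_insert,
        Set.mem_union]
      have := @hts x
      tauto
    · rintro Y (hY | rfl)
      · exact hcard Y hY
      · rw [Set.encard_coe_eq_coe_finsetCard, Finset.card_insert_of_notMem hvt, ht.card_eq]
        norm_cast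
    · intro C hC hCs
      by_cases hvC : v ∈ C
      · refine ⟨_, Or.inr rfl, Finset.coe_subset.2 fun u hu => ?_⟩
        by_cases huv : u = v
        · simp [huv]
        · have hus : u ∈ s := by simpa [huv] using hCs hu
          exact Finset.mem_insert_of_mem ((hadj u hus).1 (hC hvC hu (Ne.symm huv)))
      · obtain ⟨Y, hY, hCY⟩ := hcl C hC fun u hu => by
          have := hCs hu
          rw [Finset.mem_cons] at this
          exact this.resolve_left (by rintro rfl; exact hvC hu)
        exact ⟨Y, Or.inl hY, hCY⟩

theorem congr {T' : SimpleGraph V} {s : Finset V} (h : SpansKTree k T s)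
    (hT : ∀ u ∈ s, ∀ v ∈ s, T.Adj u v ↔ T'.Adj u v) : SpansKTree k T' s := by
  induction h with
  | complete s hs =>
    exact .complete s ⟨fun u hu v hv huv => (hT u hu v hv).1 (hs.isClique hu hv huv), hs.card_eq⟩
  | addVertex s v hv t hts ht hadj hs ih =>
    have hsub := Finset.subset_cons hv
    refine .addVertex s v hv t hts
      ⟨fun a ha b hb hab => (hT a (hsub (hts ha)) b (hsub (hts hb))).1 (ht.isClique ha hb hab),
        ht.card_eq⟩
      (fun u hu => (hT v (Finset.mem_cons_self v s) u (hsub hu)).symm.trans (hadj u hu))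
      (ih fun a ha b hb => hT a (hsub ha) b (hsub hb))

theorem exists_addVertex {s : Finset V} (h : SpansKTree k T s) {v : V} (hv : v ∉ s)
    {C : Finset V} (hC : T.IsClique (C : Set V)) (hCs : C ⊆ s) (hCk : C.card ≤ k) :
    ∃ T' : SimpleGraph V, SpansKTree k T' (Finset.cons v s hv) ∧
      (∀ a ∈ s, ∀ b ∈ s, T.Adj a b → T'.Adj a b) ∧ ∀ a ∈ C, T'.Adj v a := by
  classical
  obtain ⟨Q, hCQ, hQs, hQ⟩ := h.exists_isNClique_superset C hC hCs
  obtain ⟨t, hCt, htQ, htk⟩ := Finset.exists_subsuperset_card_eq hCQ hCk (by rw [hQ.card_eq]; omega)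
  have hts := htQ.trans hQs
  let T' : SimpleGraph V := SimpleGraph.fromRel fun a b => (a ∈ s ∧ b ∈ s ∧ T.Adj a b) ∨
    (a = v ∧ b ∈ t)
  have hadj1 : ∀ a ∈ s, ∀ b ∈ s, T.Adj a b ↔ T'.Adj a b := by
    intro a ha b hb
    have hav : a ≠ v := by rintro rfl; exact hv ha
    have hbv : b ≠ v := by rintro rfl; exact hv hb
    simp only [T', SimpleGraph.fromRel_adj, ha, hb, hav, hbv, T.adj_comm b a]
    have := T.ne_of_adj (a := a) (b := b)
    tauto
  have hadj2 : ∀ u ∈ s, T'.Adj v u ↔ u ∈ t := by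
    intro u hu
    have huv : u ≠ v := by rintro rfl; exact hv hu
    simp only [T', SimpleGraph.fromRel_adj, hu, hv, huv]
    tauto
  refine ⟨T', .addVertex s v hv t hts ⟨fun a ha b hb hab => ?_, htk⟩ hadj2 (h.congr hadj1),
    fun a ha b hb => (hadj1 a ha b hb).1, fun a ha => (hadj2 a (hCs ha)).2 (hCt ha)⟩
  exact (hadj1 a (hts ha) b (hts hb)).1 (hQ.isClique (htQ ha) (htQ hb) hab)

theorem exists_addClique {s : Finset V} (h : SpansKTree k T s) (C Y : Finset V)
    (hC : T.IsClique (C : Set V)) (hCs : C ⊆ s) (hY : Disjoint Y s)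
    (hcard : C.card + Y.card ≤ k + 1) :
    ∃ (T' : SimpleGraph V) (s' : Finset V), SpansKTree k T' s' ∧
      (s' : Set V) = (s : Set V) ∪ Y ∧ (∀ a ∈ s, ∀ b ∈ s, T.Adj a b → T'.Adj a b) ∧
      T'.IsClique ((C : Set V) ∪ Y) := by
  classical
  induction Y using Finset.induction_on generalizing C s T with
  | empty => exact ⟨T, s, h, by simp, fun _ _ _ _ => id, by simpa using hC⟩
  | insert y Y hy ih =>
    rw [Finset.card_insert_of_notMem hy] at hcard
    rw [Finset.disjoint_insert_left] at hY
    obtain ⟨T₁, h₁, hT₁, hyC⟩ := h.exists_addVertex hY.1 hC hCs (by omega)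
    obtain ⟨T', s', h', hs', hT', hcl⟩ := ih h₁ (insert y C)
      (by
        rw [Finset.coe_insert, SimpleGraph.isClique_insert]
        exact ⟨fun a ha b hb hab => hT₁ a (hCs ha) b (hCs hb) (hC ha hb hab),
          fun b hb _ => hyC b hb⟩)
      (by rw [Finset.cons_eq_insert]; exact Finset.insert_subset_insert y hCs)
      (by
        rw [Finset.cons_eq_insert, Finset.disjoint_insert_right]
        exact ⟨hy, hY.2⟩)
      (by have := Finset.card_insert_le y C; omega)
    refine ⟨T', s', h', ?_, ?_, ?_⟩
    · rw [hs']; ext x; simp; tauto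
    · intro a ha b hb hab
      exact hT' a (Finset.mem_cons_of_mem ha) b (Finset.mem_cons_of_mem hb) (hT₁ a ha b hb hab)
    · convert hcl using 1
      ext x; simp; tauto

end SpansKTree

/-- A `k`-tree meeting a tree decomposition of width at most `k` in a clique contained in one of
its bags extends to a `k`-tree in which all the bags are cliques. -/
theorem TreeBags.exists_spansKTree {k : ℕ} {V : Type*} {𝓑 : Set (Set V)} {s : Set V}
    (h : TreeBags 𝓑 s) (hcard : ∀ X ∈ 𝓑, X.encard ≤ k + 1) {T : SimpleGraph V} {S : Finset V}
    (hS : SpansKTree k T S) {X : Set V} (hX : X ∈ 𝓑) (hSs : (S : Set V) ∩ s ⊆ X)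
    (hcl : T.IsClique ((S : Set V) ∩ s)) :
    ∃ (T' : SimpleGraph V) (S' : Finset V), SpansKTree k T' S' ∧ (S' : Set V) = (S : Set V) ∪ s ∧
      (∀ a ∈ S, ∀ b ∈ S, T.Adj a b → T'.Adj a b) ∧ ∀ Y ∈ 𝓑, T'.IsClique Y := by
  classical
  induction h generalizing T S X with
  | single Z =>
    have hZ := hcard Z rfl
    have hfin : Z.Finite := Set.finite_of_encard_le_coe (k := k + 1) (by exact_mod_cast hZ)
    lift Z to Finset V using hfin
    rw [Set.encard_coe_eq_coe_finsetCard] at hZ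
    have hZ' : Z.card ≤ k + 1 := by exact_mod_cast hZ
    obtain ⟨T', S', h', hS', hT', hcl'⟩ := hS.exists_addClique (S ∩ Z) (Z \ S)
      (by simpa using hcl) Finset.inter_subset_left Finset.sdiff_disjoint
      (by rw [Finset.inter_comm]; have := Finset.card_inter_add_card_sdiff Z S; omega)
    refine ⟨T', S', h', ?_, hT', ?_⟩
    · rw [hS']; ext x; simp
    · rintro _ rfl
      convert hcl' using 1
      ext x; simp; tauto
  | @glue 𝓑 𝓒 s t A B hs ht hA hB hst ihs iht =>
    -- The bag `X` may come from either half. The half containing it is attached first, the other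
    -- one then along `s ∩ t`; stating this for arbitrary halves covers both cases.
    have key : ∀ {𝓑 𝓒 : Set (Set V)} {s t A B : Set V}, TreeBags 𝓑 s → TreeBags 𝓒 t →
        A ∈ 𝓑 → B ∈ 𝓒 → s ∩ t ⊆ A ∩ B → X ∈ 𝓑 → (S : Set V) ∩ (s ∪ t) ⊆ X →
        T.IsClique ((S : Set V) ∩ (s ∪ t)) →
        (∀ {T : SimpleGraph V} {S : Finset V}, SpansKTree k T S → ∀ {X : Set V}, X ∈ 𝓑 →
          (S : Set V) ∩ s ⊆ X → T.IsClique ((S : Set V) ∩ s) →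
          ∃ (T' : SimpleGraph V) (S' : Finset V), SpansKTree k T' S' ∧ (S' : Set V) = (S : Set V) ∪ s ∧
            (∀ a ∈ S, ∀ b ∈ S, T.Adj a b → T'.Adj a b) ∧ ∀ Y ∈ 𝓑, T'.IsClique Y) →
        (∀ {T : SimpleGraph V} {S : Finset V}, SpansKTree k T S → ∀ {X : Set V}, X ∈ 𝓒 →
          (S : Set V) ∩ t ⊆ X → T.IsClique ((S : Set V) ∩ t) →
          ∃ (T' : SimpleGraph V) (S' : Finset V), SpansKTree k T' S' ∧ (S' : Set V) = (S : Set V) ∪ t ∧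
            (∀ a ∈ S, ∀ b ∈ S, T.Adj a b → T'.Adj a b) ∧ ∀ Y ∈ 𝓒, T'.IsClique Y) →
        ∃ (T' : SimpleGraph V) (S' : Finset V), SpansKTree k T' S' ∧
          (S' : Set V) = (S : Set V) ∪ (s ∪ t) ∧
          (∀ a ∈ S, ∀ b ∈ S, T.Adj a b → T'.Adj a b) ∧ ∀ Y ∈ 𝓑 ∪ 𝓒, T'.IsClique Y := by
      intro 𝓑 𝓒 s t A B hs ht hA hB hst hX hSs hcl ihs iht
      obtain ⟨T₁, S₁, h₁, hS₁, hT₁, hcl₁⟩ := ihs hS hX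
        (fun x hx => hSs ⟨hx.1, Or.inl hx.2⟩)
        (hcl.subset (Set.inter_subset_inter_right _ Set.subset_union_left))
      have hsub : (S₁ : Set V) ∩ t ⊆ A ∩ B := by
        rw [hS₁]
        rintro x ⟨hx | hx, hxt⟩
        · exact hst ⟨hs.subset X hX (hSs ⟨hx, Or.inr hxt⟩), hxt⟩
        · exact hst ⟨hx, hxt⟩
      obtain ⟨T₂, S₂, h₂, hS₂, hT₂, hcl₂⟩ := iht h₁ hB (fun x hx => (hsub hx).2)
        ((hcl₁ A hA).subset fun x hx => (hsub hx).1)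
      have hmem : ∀ x, x ∈ S₁ ↔ x ∈ S ∨ x ∈ s := fun x => by
        rw [← Finset.mem_coe, hS₁]; rfl
      refine ⟨T₂, S₂, h₂, ?_, ?_, ?_⟩
      · rw [hS₂, hS₁, Set.union_assoc]
      · exact fun a ha b hb hab => hT₂ a ((hmem a).2 (Or.inl ha)) b ((hmem b).2 (Or.inl hb))
          (hT₁ a ha b hb hab)
      · rintro Y (hY | hY)
        · exact fun a ha b hb hab => hT₂ a ((hmem a).2 (Or.inr (hs.subset Y hY ha))) b
            ((hmem b).2 (Or.inr (hs.subset Y hY hb))) (hcl₁ Y hY ha hb hab)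
        · exact hcl₂ Y hY
    rcases hX with hX | hX
    · exact key hs ht hA hB hst hX hSs hcl (ihs fun Y hY => hcard Y (Or.inl hY))
        (iht fun Y hY => hcard Y (Or.inr hY))
    · rw [Set.union_comm s, Set.union_comm 𝓑]
      rw [Set.union_comm s] at hSs hcl
      exact key ht hs hB hA (by rw [Set.inter_comm t, Set.inter_comm B]; exact hst) hX hSs hcl
        (iht fun Y hY => hcard Y (Or.inr hY)) (ihs fun Y hY => hcard Y (Or.inl hY))

/-- A graph with a tree decomposition of width at most `k`, one of whose bags is the set of the
`k + 1` root vertices, is a rooted partial `k`-tree. -/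
theorem exists_rootedPartialKTree {k n : ℕ} (G : SimpleGraph (Fin n)) (root : Fin (k + 1) → Fin n)
    (hroot : Function.Injective root) {𝓑 : Set (Set (Fin n))} (h𝓑 : TreeBags 𝓑 Set.univ)
    (hcard : ∀ X ∈ 𝓑, X.encard ≤ k + 1) (hadj : ∀ u v, G.Adj u v → ∃ X ∈ 𝓑, u ∈ X ∧ v ∈ X)
    (hr : Set.range root ∈ 𝓑) :
    ∃ H : RootedPartialKTree k (Fin n), H.graph = G ∧ H.root = root := by
  classical
  let S : Finset (Fin n) := Finset.univ.map ⟨root, hroot⟩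
  have hSr : (S : Set (Fin n)) = Set.range root := by simp [S]
  have hS : SpansKTree k (⊤ : SimpleGraph (Fin n)) S :=
    .complete S ⟨fun a _ b _ hab => hab, by simp [S]⟩
  obtain ⟨T, S', hT, hS', -, hcl⟩ := h𝓑.exists_spansKTree hcard hS hr
    (by rw [hSr]; exact Set.inter_subset_left) (fun a _ b _ hab => hab)
  have hS'u : S' = Finset.univ := by
    rw [← Finset.coe_inj, hS']; simp
  have hle : G ≤ T := fun u v huv => by
    obtain ⟨X, hX, hu, hv⟩ := hadj u v huv
    exact hcl X hX hu hv huv.ne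
  refine ⟨⟨G, root, n, T, ⟨SimpleGraph.Hom.ofLE hle, fun _ _ h => h⟩, ?_, ?_⟩, rfl, rfl⟩
  · rw [IsKTree, ← hS'u]; exact hT
  · exact fun i j hij => hcl _ hr ⟨i, rfl⟩ ⟨j, rfl⟩ (hroot.ne hij)

namespace RootedPartialKTree

variable {k : ℕ} {V : Type*}

theorem finite_vertices (G : RootedPartialKTree k V) : Finite V := by
  obtain ⟨n, T, f, -, -⟩ := G.exists_kTree
  exact Finite.of_injective _ f.injective

theorem root_injective (G : RootedPartialKTree k V) : Function.Injective G.root := by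
  obtain ⟨n, T, f, -, h⟩ := G.exists_kTree
  intro i j hij
  by_contra hne
  have := h i j hne
  rw [hij] at this
  exact T.irrefl this

theorem exists_treeBags (G : RootedPartialKTree k V) :
    ∃ 𝓑 : Set (Set V), TreeBags 𝓑 Set.univ ∧ (∀ X ∈ 𝓑, X.encard ≤ k + 1) ∧
      (∀ u v, G.graph.Adj u v → ∃ X ∈ 𝓑, u ∈ X ∧ v ∈ X) ∧ ∃ X ∈ 𝓑, Set.range G.root ⊆ X := by
  classical
  obtain ⟨n, T, f, hT, hroot⟩ := G.exists_kTree
  obtain ⟨𝓑, h𝓑, hcard, hcl⟩ := SpansKTree.exists_treeBags hT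
  refine ⟨(f ⁻¹' ·) '' 𝓑, ?_, ?_, ?_, ?_⟩
  · simpa using h𝓑.preimage f
  · rintro _ ⟨X, hX, rfl⟩
    refine le_trans ?_ (hcard X hX)
    rw [← (show Function.Injective f from f.injective).encard_image]
    exact Set.encard_le_encard (Set.image_preimage_subset _ _)
  · intro u v huv
    have huv' : T.Adj (f u) (f v) := f.toHom.map_adj huv
    obtain ⟨X, hX, hsub⟩ := hcl {f u, f v}
      (by
        rw [Finset.coe_pair, SimpleGraph.isClique_pair]
        exact fun _ => huv')
      (Finset.subset_univ _)
    exact ⟨_, ⟨X, hX, rfl⟩, hsub (by simp), hsub (by simp)⟩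
  · obtain ⟨X, hX, hsub⟩ := hcl (Finset.univ.image fun i => f (G.root i))
      (by
        rw [Finset.coe_image, Finset.coe_univ]
        rintro _ ⟨i, -, rfl⟩ _ ⟨j, -, rfl⟩ hij
        exact hroot i j fun h => hij (by rw [h]))
      (Finset.subset_univ _)
    refine ⟨_, ⟨X, hX, rfl⟩, ?_⟩
    rintro _ ⟨i, rfl⟩
    exact hsub (by simp)

end RootedPartialKTree

/-! ### Rotating colors and gluing colorings -/

/-- The relation required of the colors of adjacent vertices in a `(p,q)`-coloring. -/
def CircularAdj (p q : ℕ) (a b : Fin p) : Prop :=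
  (q : ℤ) ≤ |((a : ℕ) : ℤ) - ((b : ℕ) : ℤ)| ∧ |((a : ℕ) : ℤ) - ((b : ℕ) : ℤ)| ≤ (p : ℤ) - (q : ℤ)

theorem CircularAdj.symm {p q : ℕ} {a b : Fin p} (h : CircularAdj p q a b) :
    CircularAdj p q b a := by
  rwa [CircularAdj, abs_sub_comm]

/-- Since `b - a` lies in `[q, p - q]`, the quotients of `a` and `b` by `p` differ by at most one.
The residues then differ by `b - a` or by `p - (b - a)`, and both lie in that interval. -/
theorem circularAdj_ofNat {p q : ℕ} [NeZero p] (hq : 0 < q) (a b : ℕ) (h₁ : a + q ≤ b)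
    (h₂ : b + q ≤ a + p) : CircularAdj p q (Fin.ofNat p a) (Fin.ofNat p b) := by
  have hp : 0 < p := NeZero.pos p
  have ha := Nat.div_add_mod a p
  have hb := Nat.div_add_mod b p
  have ha' := Nat.mod_lt a hp
  have hb' := Nat.mod_lt b hp
  simp only [CircularAdj, Fin.val_ofNat]
  generalize a % p = r at *
  generalize b % p = t at *
  generalize a / p = x at *
  generalize b / p = y at *
  have hxy : x ≤ y := by
    by_contra! hlt
    have := Nat.mul_le_mul_left p (Nat.succ_le_of_lt hlt)
    rw [Nat.mul_succ] at this
    omega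
  have hyx : y ≤ x + 1 := by
    by_contra! hlt
    have := Nat.mul_le_mul_left p (Nat.succ_le_of_lt hlt)
    rw [Nat.mul_succ, Nat.mul_succ] at this
    omega
  obtain rfl | rfl : y = x ∨ y = x + 1 := by omega
  · rw [abs_of_nonpos (by omega)]; omega
  · rw [Nat.mul_succ] at hb
    rw [abs_of_nonneg (by omega)]; omega

/-- The color at time `t` of a vertex of the given side in a homotopy that rotates the pair
`(x, x + q)` of adjacent colors to the pair `(0, q)`. -/
def rotatingColor (p q : ℕ) [NeZero p] (x : ℕ) (side : Fin 2) (t : ℕ) : Fin p :=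
  if side = 0 then Fin.ofNat p (x + min t (2 * (p - x)) / 2)
  else Fin.ofNat p (x + q + (min t (2 * (p - x)) + 1) / 2)

section rotatingColor

variable {p q : ℕ} [NeZero p]

/-- One side rounds half the time down and the other rounds it up, so before reduction modulo `p`
the colors differ by `q` or `q + 1`. Both are admissible because `2 * q < p`. -/
theorem circularAdj_rotatingColor (hq : 0 < q) (hpq : 2 * q < p) (x : ℕ) {t t' : ℕ}
    (h₁ : t ≤ t' + 1) (h₂ : t' ≤ t + 1) :
    CircularAdj p q (rotatingColor p q x 0 t) (rotatingColor p q x 1 t') := by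
  simp only [rotatingColor, if_true, one_ne_zero, if_false]
  apply circularAdj_ofNat hq <;> omega

theorem rotatingColor_zero_of_le_one (x : Fin p) {t : ℕ} (ht : t ≤ 1) :
    rotatingColor p q x 0 t = x := by
  have : min t (2 * (p - x)) / 2 = 0 := by omega
  simp [rotatingColor, this]

/-- By then the pair has stopped at `(p, p + q)`, which does not depend on `x`. -/
theorem rotatingColor_of_le (x : Fin p) (side : Fin 2) {t : ℕ} (ht : 2 * p ≤ t) :
    rotatingColor p q x side t = rotatingColor p q 0 side (2 * p) := by
  have hx := x.2
  have h₁ : (x : ℕ) + min t (2 * (p - x)) / 2 = 0 + min (2 * p) (2 * (p - 0)) / 2 := by omega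
  have h₂ : (x : ℕ) + q + (min t (2 * (p - x)) + 1) / 2 =
    0 + q + (min (2 * p) (2 * (p - 0)) + 1) / 2 := by omega
  simp only [rotatingColor, h₁, h₂]

theorem circularAdj_rotatingColor_of_ne (hq : 0 < q) (hpq : 2 * q < p) (x : ℕ) {a b : Fin 2}
    (hab : a ≠ b) {t t' : ℕ} (h₁ : t ≤ t' + 1) (h₂ : t' ≤ t + 1) :
    CircularAdj p q (rotatingColor p q x a t) (rotatingColor p q x b t') := by
  obtain ⟨rfl, rfl⟩ | ⟨rfl, rfl⟩ : (a = 0 ∧ b = 1) ∨ (a = 1 ∧ b = 0) := by omega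
  · exact circularAdj_rotatingColor hq hpq x h₁ h₂
  · exact (circularAdj_rotatingColor hq hpq x h₂ h₁).symm

end rotatingColor

/-- The vertices at level at least `R`, where the levels are rounded so that the vertices of the
boundary of this set all lie on side `0`. -/
def Outside {V : Type*} (side : V → Fin 2) (d : V → ℕ) (R : ℕ) (v : V) : Prop :=
  R + (side v : ℕ) ≤ d v

section Coloring

variable {V : Type*} {G : SimpleGraph V} {p q : ℕ} [NeZero p]

/-- The level above `R` serves as time. An outside vertex with a neighbor that is not outside lies
on side `0` at level at most `R + 1`; at such times side `0` has not yet moved, so the rotation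
matches `c` along the boundary. -/
theorem exists_coloring_eq_rotatingColor (hq : 0 < q) (hpq : 2 * q < p) {side : V → Fin 2}
    (hside : ∀ u v, G.Adj u v → side u ≠ side v) {d : V → ℕ}
    (hd : ∀ u v, G.Adj u v → d u ≤ d v + 1) {R : ℕ} {c : V → Fin p}
    (hc : ∀ u v, G.Adj u v → ¬(Outside side d R u ∧ Outside side d R v) →
      CircularAdj p q (c u) (c v))
    (hc' : ∀ u v, G.Adj u v → Outside side d R u → Outside side d R v → c u = c v) :
    ∃ C : V → Fin p, IsCircularColoring p q G C ∧ (∀ v, ¬Outside side d R v → C v = c v) ∧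
      ∀ v, R + 2 * p ≤ d v → C v = rotatingColor p q 0 (side v) (2 * p) := by
  classical
  refine ⟨fun v => if Outside side d R v then rotatingColor p q (c v) (side v) (d v - R) else c v,
    ?_, fun v hv => if_neg hv, ?_⟩
  · have key : ∀ u v, G.Adj u v → ¬Outside side d R u → Outside side d R v →
        CircularAdj p q (c u) (rotatingColor p q (c v) (side v) (d v - R)) := by
      intro u v huv hu hv
      have h₁ := hside u v huv
      have h₂ := hd v u huv.symm
      have h₃ := hd u v huv
      have h₄ := hc u v huv fun h => hu h.1
      simp only [Outside] at hu hv
      obtain ⟨h₅, h₆⟩ : side v = 0 ∧ side u = 1 := by omega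
      rw [h₅, rotatingColor_zero_of_le_one _ (by rw [h₆] at hu; simp at hu; omega)]
      exact h₄
    intro u v huv
    change CircularAdj p q (ite _ _ _) (ite _ _ _)
    by_cases hu : Outside side d R u <;> by_cases hv : Outside side d R v
    · rw [if_pos hu, if_pos hv, hc' u v huv hu hv]
      have := hd v u huv.symm
      have := hd u v huv
      exact circularAdj_rotatingColor_of_ne hq hpq _ (hside u v huv) (by omega) (by omega)
    · rw [if_pos hu, if_neg hv]
      exact (key v u huv.symm hv hu).symm
    · rw [if_neg hu, if_pos hv]
      exact key u v huv hu hv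
    · rw [if_neg hu, if_neg hv]
      exact hc u v huv fun h => hu h.1
  · intro v hv
    have hp := NeZero.pos p
    have hout : Outside side d R v := by unfold Outside; omega
    simp only [if_pos hout]
    exact rotatingColor_of_le _ _ (by omega)

/-- Below level `N` of `i` the coloring is `C i`, elsewhere the common final pair. At level exactly
`N` the two agree, so an edge with one end below level `N` is colored by `C i` at both ends. -/
theorem exists_coloring_of_separated (hq : 0 < q) (hpq : 2 * q < p) {side : V → Fin 2}
    (hside : ∀ u v, G.Adj u v → side u ≠ side v) {ι : Type*} {d : ι → V → ℕ}
    (hd : ∀ i u v, G.Adj u v → d i u ≤ d i v + 1) {N : ℕ}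
    (hsep : ∀ i j v, d i v ≤ N → d j v ≤ N → i = j) {C : ι → V → Fin p}
    (hC : ∀ i, IsCircularColoring p q G (C i))
    (hC' : ∀ i v, N ≤ d i v → C i v = rotatingColor p q 0 (side v) (2 * p)) :
    ∃ c : V → Fin p, IsCircularColoring p q G c ∧ ∀ i v, d i v ≤ N → c v = C i v := by
  classical
  let c : V → Fin p := fun v => if h : ∃ i, d i v < N then C h.choose v
    else rotatingColor p q 0 (side v) (2 * p)
  have hc : ∀ i v, d i v ≤ N → c v = C i v := by
    intro i v hv
    by_cases h : ∃ i, d i v < N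
    · have : h.choose = i := hsep _ _ v h.choose_spec.le hv
      simp only [c, dif_pos h, this]
    · simp only [c, dif_neg h]
      push Not at h
      exact (hC' i v (h i)).symm
  refine ⟨c, fun u v huv => ?_, hc⟩
  by_cases h : ∃ i, d i u < N ∨ d i v < N
  · obtain ⟨i, hi⟩ := h
    have h₁ := hd i u v huv
    have h₂ := hd i v u huv.symm
    rw [hc i u (by omega), hc i v (by omega)]
    exact hC i u v huv
  · push Not at h
    have hu : ¬∃ i, d i u < N := fun ⟨i, hi⟩ => absurd (h i).1 (by omega)
    have hv : ¬∃ i, d i v < N := fun ⟨i, hi⟩ => absurd (h i).2 (by omega)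
    simp only [c, dif_neg hu, dif_neg hv]
    exact circularAdj_rotatingColor_of_ne hq hpq _ (hside u v huv) (by omega) (by omega)

end Coloring

/-! ### Truncated distances and contracted copies -/

/-- The distance of `v` from the set `A`, truncated at `M`. -/
noncomputable def cappedDist {V : Type*} (G : SimpleGraph V) (A : Set V) (M : ℕ) (v : V) : ℕ :=
  ((⨅ a ∈ A, G.edist a v) ⊓ (M : ℕ∞)).toNat

section cappedDist

variable {V : Type*} {G : SimpleGraph V} {A : Set V} {M : ℕ}

theorem coe_cappedDist (v : V) :
    (cappedDist G A M v : ℕ∞) = (⨅ a ∈ A, G.edist a v) ⊓ (M : ℕ∞) :=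
  ENat.natCast_toNat (ne_top_of_le_ne_top (ENat.natCast_ne_top M) inf_le_right)

theorem cappedDist_le_cap (v : V) : cappedDist G A M v ≤ M := by
  have : (cappedDist G A M v : ℕ∞) ≤ M := by rw [coe_cappedDist]; exact inf_le_right
  exact_mod_cast this

theorem cappedDist_le_edist {a : V} (ha : a ∈ A) (v : V) :
    (cappedDist G A M v : ℕ∞) ≤ G.edist a v := by
  rw [coe_cappedDist]
  exact inf_le_left.trans (iInf₂_le a ha)

theorem exists_edist_le_cappedDist {v : V} (h : cappedDist G A M v < M) :
    ∃ a ∈ A, G.edist a v ≤ cappedDist G A M v := by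
  have h₁ := coe_cappedDist (G := G) (A := A) (M := M) v
  have h₂ : (cappedDist G A M v : ℕ∞) < M := by exact_mod_cast h
  have h₃ : (⨅ a ∈ A, G.edist a v) < (cappedDist G A M v : ℕ∞) + 1 := by
    rw [ENat.lt_add_one_iff (ENat.natCast_ne_top _)]
    rcases le_total (⨅ a ∈ A, G.edist a v) (M : ℕ∞) with h | h
    · rw [h₁, inf_eq_left.2 h]
    · rw [h₁, inf_eq_right.2 h] at h₂
      exact absurd h₂ (lt_irrefl _)
  simp only [iInf_lt_iff] at h₃
  obtain ⟨a, ha, h₄⟩ := h₃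
  exact ⟨a, ha, (ENat.lt_add_one_iff (ENat.natCast_ne_top _)).1 h₄⟩

theorem cappedDist_le_add_one {u v : V} (huv : G.Adj u v) :
    cappedDist G A M u ≤ cappedDist G A M v + 1 := by
  rcases lt_or_ge (cappedDist G A M v) M with h | h
  · obtain ⟨a, ha, hav⟩ := exists_edist_le_cappedDist h
    have h₁ : (cappedDist G A M u : ℕ∞) ≤ (cappedDist G A M v : ℕ∞) + 1 :=
      calc (cappedDist G A M u : ℕ∞) ≤ G.edist a u := cappedDist_le_edist ha u
        _ ≤ G.edist a v + G.edist v u := G.edist_triangle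
        _ ≤ _ := add_le_add hav (SimpleGraph.edist_eq_one_iff_adj.2 huv.symm).le
    exact_mod_cast h₁
  · exact (cappedDist_le_cap u).trans (by omega)

end cappedDist

/-- The union of one contracted copy of `G` for each index `i`: the map `f i` sends a vertex of
`G` to its image in the `i`-th copy, and edges inside the contracted part `out i` are deleted. -/
def contractedCopies {ι V W : Type*} (G : SimpleGraph V) (out : ι → V → Prop) (f : ι → V → W) :
    SimpleGraph W where
  Adj w w' := w ≠ w' ∧ ∃ i u v, f i u = w ∧ f i v = w' ∧ G.Adj u v ∧ ¬(out i u ∧ out i v)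
  symm := ⟨fun _ _ ⟨h, i, u, v, hu, hv, huv, ho⟩ =>
    ⟨h.symm, i, v, u, hv, hu, huv.symm, fun h' => ho h'.symm⟩⟩
  loopless := ⟨fun _ h => h.1 rfl⟩

section contractedCopies

variable {ι V W : Type*} {G : SimpleGraph V} {out : ι → V → Prop} {f : ι → V → W}

theorem contractedCopies_adj (hf : ∀ i u v, f i u = f i v → u = v ∨ (out i u ∧ out i v)) {i : ι}
    {u v : V} (huv : G.Adj u v) (ho : ¬(out i u ∧ out i v)) :
    (contractedCopies G out f).Adj (f i u) (f i v) :=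
  ⟨fun h => (hf i u v h).elim huv.ne ho, i, u, v, rfl, rfl, huv, ho⟩

theorem contractedCopies_reachable (hι : ∀ i j u v, f i u = f j v → i = j) {i j : ι} {u v : V}
    (h : (contractedCopies G out f).Reachable (f i u) (f j v)) : i = j := by
  obtain ⟨P⟩ := h
  have key : ∀ w w', (contractedCopies G out f).Walk w w' → w' = f j v → ∃ x, w = f j x := by
    intro w w' P hw
    induction P with
    | nil => exact ⟨v, hw⟩
    | cons h P ih =>
      obtain ⟨x, hx⟩ := ih hw
      obtain ⟨-, i', u', v', rfl, rfl, -⟩ := h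
      exact ⟨u', by rw [hι i' j v' x hx]⟩
  obtain ⟨x, hx⟩ := key _ _ P rfl
  exact hι _ _ _ _ hx

/-- Seen from its end `f i a`, the walk lifts to `G` until it meets a contracted vertex, and
reaching one already costs at least `R` steps. -/
theorem le_length_or_edist_le (hι : ∀ i j u v, f i u = f j v → i = j)
    (hf : ∀ i u v, f i u = f i v → u = v ∨ (out i u ∧ out i v)) {i : ι} {a : V} {R : ℕ}
    (ha : ¬out i a) (hR : ∀ v, out i v → (R : ℕ∞) ≤ G.edist v a) {w w' : W}
    (P : (contractedCopies G out f).Walk w w') (hw : w' = f i a) :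
    R ≤ P.length ∨ ∃ v, ¬out i v ∧ w = f i v ∧ G.edist v a ≤ P.length := by
  induction P with
  | nil => exact Or.inr ⟨a, ha, hw, by simp⟩
  | cons h P ih =>
    rw [SimpleGraph.Walk.length_cons]
    rcases ih hw with hP | ⟨v, hv, hwv, hP⟩
    · exact Or.inl (by omega)
    · obtain ⟨-, i', u', v', rfl, rfl, huv, ho⟩ := h
      obtain rfl := hι _ _ _ _ hwv
      obtain rfl : v' = v := (hf _ _ _ hwv).resolve_right fun h => hv h.2
      have hle : G.edist u' a ≤ ((P.length + 1 : ℕ) : ℕ∞) :=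
        calc G.edist u' a ≤ G.edist u' v' + G.edist v' a := G.edist_triangle
          _ ≤ 1 + P.length := add_le_add (SimpleGraph.edist_eq_one_iff_adj.2 huv).le hP
          _ = _ := by rw [add_comm]; norm_cast
      by_cases hu : out i' u'
      · left
        exact_mod_cast (hR u' hu).trans hle
      · exact Or.inr ⟨u', hu, rfl, hle⟩

theorem edist_contractedCopies_le (hf : ∀ i u v, f i u = f i v → u = v ∨ (out i u ∧ out i v))
    {i : ι} {a : V} {R : ℕ} (hR : ∀ v, out i v → (R : ℕ∞) ≤ G.edist v a) {v a' : V}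
    (P : G.Walk v a') (ha' : a' = a) (hP : P.length < R) :
    (contractedCopies G out f).edist (f i v) (f i a) ≤ P.length := by
  induction P with
  | nil => rw [ha']; simp
  | @cons x y z h P ih =>
    have hx : ¬out i x := fun hx => by
      subst ha'
      have := (hR x hx).trans (SimpleGraph.edist_le (SimpleGraph.Walk.cons h P))
      rw [Nat.cast_le] at this
      omega
    rw [SimpleGraph.Walk.length_cons] at hP ⊢
    calc _ ≤ (contractedCopies G out f).edist (f i x) (f i y) +
          (contractedCopies G out f).edist (f i y) (f i a) := SimpleGraph.edist_triangle
      _ ≤ 1 + P.length := add_le_add (SimpleGraph.edist_eq_one_iff_adj.2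
          (contractedCopies_adj hf h fun h => hx h.1)).le (ih ha' (by omega))
      _ = _ := by rw [add_comm]; norm_cast

theorem edist_contractedCopies_eq (hι : ∀ i j u v, f i u = f j v → i = j)
    (hf : ∀ i u v, f i u = f i v → u = v ∨ (out i u ∧ out i v)) {i : ι} {a b : V} {R : ℕ}
    (ha : ¬out i a) (hR : ∀ v, out i v → (R : ℕ∞) ≤ G.edist v a)
    (hab : G.edist b a < R) :
    (contractedCopies G out f).edist (f i b) (f i a) = G.edist b a := by
  apply le_antisymm
  · obtain ⟨P, hP⟩ := SimpleGraph.exists_walk_of_edist_ne_top hab.ne_top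
    rw [← hP] at hab ⊢
    exact edist_contractedCopies_le hf hR P rfl (by exact_mod_cast hab)
  · by_cases htop : (contractedCopies G out f).edist (f i b) (f i a) = ⊤
    · rw [htop]; exact le_top
    · obtain ⟨P, hP⟩ := SimpleGraph.exists_walk_of_edist_ne_top htop
      rw [← hP]
      rcases le_length_or_edist_le hι hf ha hR P rfl with h | ⟨v, hv, hbv, h⟩
      · exact hab.le.trans (by exact_mod_cast h)
      · obtain rfl := (hf _ _ _ hbv).resolve_right fun h => hv h.2
        exact h

theorem contractedCopies_isBipartite (hι : ∀ i j u v, f i u = f j v → i = j)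
    (hf : ∀ i u v, f i u = f i v → u = v ∨ (out i u ∧ out i v))
    (hsurj : ∀ w, ∃ i v, f i v = w) {side : V → Fin 2}
    (hside : ∀ u v, G.Adj u v → side u ≠ side v)
    (hout : ∀ i u v, G.Adj u v → ¬out i u → out i v → side v = 0) :
    (contractedCopies G out f).IsBipartite := by
  classical
  choose gi gv hg using hsurj
  -- A contracted region may contain both sides, but its boundary lies on side `0` by `hout`, so
  -- side `0` is a valid choice for the whole region.
  let σ : ι → V → Fin 2 := fun i v => if out i v then 0 else side v
  have hσ : ∀ i v, σ (gi (f i v)) (gv (f i v)) = σ i v := by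
    intro i v
    have h := hg (f i v)
    have hi := hι _ _ _ _ h
    rw [hi] at h ⊢
    rcases hf _ _ _ h with h | ⟨h₁, h₂⟩
    · rw [h]
    · simp only [σ, if_pos h₁, if_pos h₂]
  refine ⟨SimpleGraph.Coloring.mk (fun w => σ (gi w) (gv w)) ?_⟩
  rintro _ _ ⟨-, i, u, v, rfl, rfl, huv, ho⟩
  rw [hσ, hσ]
  have h := hside u v huv
  by_cases hu : out i u <;> by_cases hv : out i v
  · exact absurd ⟨hu, hv⟩ ho
  · simpa only [σ, if_pos hu, if_neg hv, hout i v u huv.symm hv hu] using h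
  · simpa only [σ, if_pos hv, if_neg hu, hout i u v huv hu hv] using h
  · simpa only [σ, if_neg hu, if_neg hv] using h

end contractedCopies

theorem exists_quotient_maps {ι V : Type*} [Finite ι] [Finite V] (r : ι → V → V → Prop)
    (hr : ∀ i, Equivalence (r i)) :
    ∃ (n : ℕ) (f : ι → V → Fin n), (∀ w, ∃ i v, f i v = w) ∧
      (∀ i j u v, f i u = f j v → i = j) ∧ ∀ i u v, f i u = f i v ↔ r i u v := by
  let S : Setoid (ι × V) :=
    { r := fun x y => x.1 = y.1 ∧ r x.1 x.2 y.2
      iseqv :=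
        { refl := fun x => ⟨rfl, (hr _).refl _⟩
          symm := fun {x y} h => ⟨h.1.symm, h.1 ▸ (hr _).symm h.2⟩
          trans := fun {x y z} h h' =>
            ⟨h.1.trans h'.1, (hr _).trans h.2 (h.1.symm ▸ h'.2)⟩ } }
  obtain ⟨n, ⟨e⟩⟩ := Finite.exists_equiv_fin (Quotient S)
  have key : ∀ x y : ι × V, e ⟦x⟧ = e ⟦y⟧ ↔ x.1 = y.1 ∧ r x.1 x.2 y.2 := fun x y => by
    rw [e.apply_eq_iff_eq, Quotient.eq]; rfl
  refine ⟨n, fun i v => e ⟦(i, v)⟧, fun w => ?_, fun i j u v h => ((key _ _).1 h).1,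
    fun i u v => (key _ _).trans (and_iff_right rfl)⟩
  obtain ⟨⟨i, v⟩, h⟩ := Quotient.exists_rep (e.symm w)
  exact ⟨i, v, (congrArg e h).trans (e.apply_symm_apply w)⟩

/-! ### Separating the clusters -/

theorem RootedPartialKTree.exists_contracted_decomposition {k : ℕ} {V : Type*}
    (G : RootedPartialKTree k V) {ι : Type*} [Finite ι] (out : ι → V → Prop)
    (cl : Fin (k + 1) → ι) (hcl : ∀ j, ¬out (cl j) (G.root j)) :
    ∃ (n : ℕ) (f : ι → V → Fin n), (∀ w, ∃ i v, f i v = w) ∧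
      (∀ i j u v, f i u = f j v → i = j) ∧
      (∀ i u v, f i u = f i v → u = v ∨ (out i u ∧ out i v)) ∧
      (∀ i u v, G.graph.Adj u v → out i u → out i v → f i u = f i v) ∧
      ∃ H : RootedPartialKTree k (Fin n), H.graph = contractedCopies G.graph out f ∧
        H.root = fun j => f (cl j) (G.root j) := by
  classical
  have := G.finite_vertices
  have := Fintype.ofFinite ι
  obtain ⟨𝓑, h𝓑, hcard, hadj, X₀, hX₀, hroot⟩ := G.exists_treeBags
  -- Links through common bags identify adjacent outside vertices and give exactly the connectedness
  -- that `TreeBags.image` requires.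
  let link : ι → V → V → Prop := fun i u v => out i u ∧ out i v ∧ ∃ X ∈ 𝓑, u ∈ X ∧ v ∈ X
  have hlink : ∀ i, Std.Symm (link i) := fun i => ⟨fun u v ⟨hu, hv, X, hX, hu', hv'⟩ =>
    ⟨hv, hu, X, hX, hv', hu'⟩⟩
  have hr : ∀ i, Equivalence (ReflTransGen (link i)) := fun i =>
    ⟨fun _ => .refl, fun {_ _} h => ReflTransGen.stdSymm.symm _ _ h, fun h h' => h.trans h'⟩
  obtain ⟨n, f, hsurj, hι, hf⟩ := exists_quotient_maps (fun i => ReflTransGen (link i)) hr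
  have hf' : ∀ i u v, f i u = f i v → u = v ∨ (out i u ∧ out i v) := by
    intro i u v huv
    have h := (hf i u v).1 huv
    rcases h.cases_head with rfl | ⟨x, hx, -⟩
    · exact Or.inl rfl
    rcases h.cases_tail with rfl | ⟨y, -, hy⟩
    · exact Or.inl rfl
    exact Or.inr ⟨hx.1, hy.2.1⟩
  refine ⟨n, f, hsurj, hι, hf', fun i u v huv hu hv => (hf i u v).2 (.single ⟨hu, hv, hadj u v huv⟩),
    ?_⟩
  set root' : Fin (k + 1) → Fin n := fun j => f (cl j) (G.root j) with hroot'
  have hinj : Function.Injective root' := by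
    intro j j' h
    have hcc := hι _ _ _ _ h
    simp only [hroot', ← hcc] at h
    exact G.root_injective ((hf' _ _ _ h).resolve_right fun h' => hcl j h'.1)
  have himage : ∀ i, TreeBags ((f i '' ·) '' 𝓑) (f i '' Set.univ) := fun i =>
    h𝓑.image (f i) fun x _ y _ hxy => ReflTransGen.mono
      (show link i ≤ BagLink 𝓑 (f i) from fun a b hab =>
        ⟨(hf i a b).2 (.single hab), hab.2.2⟩) x y ((hf i x y).1 hxy)
  -- The new root is the central bag: it meets the copy `i` only in images of old root vertices,
  -- which lie in `f i '' X₀`.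
  have hstar := TreeBags.star Finset.univ (Set.range root') (fun i => (f i '' ·) '' 𝓑)
    (fun i => f i '' Set.univ) (fun i => f i '' X₀) himage (fun i => ⟨X₀, hX₀, rfl⟩)
    (by
      rintro i _ ⟨⟨j, rfl⟩, ⟨v, -, hv⟩⟩
      obtain rfl := hι _ _ _ _ hv
      exact ⟨G.root j, hroot ⟨j, rfl⟩, rfl⟩)
    (by
      intro i j hij
      rw [Set.disjoint_left]
      rintro _ ⟨u, -, rfl⟩ ⟨v, -, hv⟩
      exact hij (hι _ _ _ _ hv).symm)
  have huniv : (Set.range root' ∪ ⋃ i ∈ Finset.univ, f i '' Set.univ) = Set.univ := by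
    refine Set.eq_univ_of_forall fun w => Or.inr ?_
    obtain ⟨i, v, rfl⟩ := hsurj w
    simp only [Finset.mem_univ, Set.iUnion_true, Set.mem_iUnion]
    exact ⟨i, v, trivial, rfl⟩
  rw [huniv] at hstar
  refine exists_rootedPartialKTree _ root' hinj hstar ?_ ?_ (Or.inl rfl)
  · rintro X (rfl | hX)
    · rw [← Set.image_univ]
      refine (Set.encard_image_le _ _).trans ?_
      rw [Set.encard_univ, ENat.card_eq_coe_fintype_card, Fintype.card_fin]
      norm_cast
    · simp only [Set.mem_iUnion] at hX
      obtain ⟨i, -, Y, hY, rfl⟩ := hX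
      exact (Set.encard_image_le _ _).trans (hcard Y hY)
  · rintro _ _ ⟨-, i, u, v, rfl, rfl, huv, -⟩
    obtain ⟨X, hX, hu, hv⟩ := hadj u v huv
    refine ⟨f i '' X, Or.inr ?_, ⟨u, hu, rfl⟩, ⟨v, hv, rfl⟩⟩
    simp only [Finset.mem_univ, Set.iUnion_true, Set.mem_iUnion]
    exact ⟨i, X, hX, rfl⟩

/-- If the root splits into clusters that are far apart compared to their diameters, then the
graph can be replaced by one with fewer extendable precolorings, in which different clusters lie
in different components and the distances inside the clusters are unchanged. -/
theorem RootedPartialKTree.exists_separated_clusters {k p q : ℕ} (hq : 0 < q) (hpq : 2 * q < p)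
    {V : Type*} (G : RootedPartialKTree k V) (hG : G.graph.IsBipartite) {D : ℕ} {ι : Type*}
    [Finite ι] (cl : Fin (k + 1) → ι) (hnear : ∀ i j, cl i = cl j → G.distType i j ≤ D)
    (hfar : ∀ i j, cl i ≠ cl j → ((2 * D + 4 * p + 3 : ℕ) : ℕ∞) ≤ G.distType i j) :
    ∃ (n : ℕ) (H : RootedPartialKTree k (Fin n)), H.graph.IsBipartite ∧
      H.extendable p q ⊆ G.extendable p q ∧
      (∀ i j, cl i = cl j → H.distType i j = G.distType i j) ∧
      ∀ i j, cl i ≠ cl j → H.distType i j = ⊤ := by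
  classical
  have : NeZero p := ⟨by omega⟩
  obtain ⟨side⟩ := hG
  have hside : ∀ u v, G.graph.Adj u v → side u ≠ side v := fun u v huv => side.valid huv
  simp only [RootedPartialKTree.distType, Matrix.of_apply] at hnear hfar ⊢
  -- Contraction starts at level `D + 1` and a full rotation takes at most `2 * p` further levels.
  -- The bound in `hfar` exceeds `2 * N`, so the `N`-neighborhoods of distinct clusters are
  -- disjoint.
  let N := D + 1 + 2 * p
  let A : ι → Set V := fun i => {v | ∃ j, cl j = i ∧ G.root j = v}
  -- Truncation at `N + 1` keeps levels finite and still detects whether the true distance is at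
  -- most `N`.
  let d : ι → V → ℕ := fun i => cappedDist G.graph (A i) (N + 1)
  have hd : ∀ i u v, G.graph.Adj u v → d i u ≤ d i v + 1 := fun i u v huv =>
    cappedDist_le_add_one huv
  have hroot : ∀ j, d (cl j) (G.root j) = 0 := fun j => by
    have h := cappedDist_le_edist (G := G.graph) (A := A (cl j)) (M := N + 1)
      (a := G.root j) ⟨j, rfl, rfl⟩ (G.root j)
    rw [SimpleGraph.edist_self] at h
    exact_mod_cast nonpos_iff_eq_zero.1 h
  have hsep : ∀ i j v, d i v ≤ N → d j v ≤ N → i = j := by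
    intro i j v hi hj
    obtain ⟨_, ⟨a, rfl, rfl⟩, ha⟩ := exists_edist_le_cappedDist (Nat.lt_succ_of_le hi)
    obtain ⟨_, ⟨b, rfl, rfl⟩, hb⟩ := exists_edist_le_cappedDist (Nat.lt_succ_of_le hj)
    by_contra hne
    have h : ((2 * D + 4 * p + 3 : ℕ) : ℕ∞) ≤ (N + N : ℕ) :=
      calc _ ≤ G.graph.edist (G.root a) (G.root b) := hfar a b hne
        _ ≤ G.graph.edist (G.root a) v + G.graph.edist v (G.root b) :=
          SimpleGraph.edist_triangle
        _ ≤ (N : ℕ∞) + N := by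
          rw [SimpleGraph.edist_comm (u := v)]
          exact add_le_add (ha.trans (by exact_mod_cast hi)) (hb.trans (by exact_mod_cast hj))
        _ = _ := by norm_cast
    rw [Nat.cast_le] at h
    omega
  let out : ι → V → Prop := fun i => Outside side (d i) (D + 1)
  have hrout : ∀ j, ¬out (cl j) (G.root j) := fun j h => by
    have : D + 1 + _ ≤ d (cl j) (G.root j) := h
    rw [hroot] at this
    omega
  have hout : ∀ j v, out (cl j) v → ((D + 1 : ℕ) : ℕ∞) ≤ G.graph.edist v (G.root j) := by
    intro j v h
    rw [SimpleGraph.edist_comm]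
    refine le_trans ?_ (cappedDist_le_edist (M := N + 1) (A := A (cl j)) ⟨j, rfl, rfl⟩ v)
    exact_mod_cast (Nat.le_add_right _ _).trans h
  obtain ⟨n, f, hsurj, hι, hf, hf', H, hHg, hHr⟩ :=
    G.exists_contracted_decomposition out cl hrout
  refine ⟨n, H, ?_, ?_, ?_, ?_⟩
  · rw [hHg]
    refine contractedCopies_isBipartite hι hf hsurj hside fun i u v huv hu hv => ?_
    have h₁ := hside u v huv
    have h₂ := hd i v u huv.symm
    simp only [out, Outside] at hu hv
    omega
  · rintro φ ⟨c, hc, hφ⟩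
    rw [hHg] at hc
    have hex : ∀ i, ∃ C : V → Fin p, IsCircularColoring p q G.graph C ∧
        (∀ v, ¬out i v → C v = c (f i v)) ∧
        ∀ v, N ≤ d i v → C v = rotatingColor p q 0 (side v) (2 * p) := fun i =>
      exists_coloring_eq_rotatingColor hq hpq hside (hd i) (c := fun v => c (f i v))
        (fun u v huv ho => hc _ _ (contractedCopies_adj hf huv ho))
        fun u v huv hu hv => congrArg c (hf' i u v huv hu hv)
    choose C hC hCc hCN using hex
    obtain ⟨c', hc', hcC⟩ := exists_coloring_of_separated hq hpq hside hd hsep hC hCN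
    refine ⟨c', hc', fun j => ?_⟩
    rw [hcC (cl j) (G.root j) (by rw [hroot]; exact Nat.zero_le _), hCc _ _ (hrout j), ← hφ j,
      hHr]
  · intro i j hij
    rw [hHg, hHr]
    have hi := hrout i
    have hi' := hout i
    have hn := hnear j i hij.symm
    simp only [← hij]
    rw [SimpleGraph.edist_comm, SimpleGraph.edist_comm (u := G.root i)]
    exact edist_contractedCopies_eq hι hf hi hi' (hn.trans_lt (by exact_mod_cast D.lt_succ_self))
  · intro i j hij
    rw [hHg, hHr]
    by_contra h
    exact hij (contractedCopies_reachable hι (SimpleGraph.reachable_of_edist_ne_top h))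

/-! ### Gaps between distances, and finiteness -/

/-- The thresholds among which a gap in the distances between root vertices is found. -/
def gapThreshold (p : ℕ) : ℕ → ℕ
  | 0 => 0
  | m + 1 => 2 * gapThreshold p m + 4 * p + 3

theorem gapThreshold_monotone (p : ℕ) : Monotone (gapThreshold p) :=
  monotone_nat_of_le_succ fun m => by rw [gapThreshold]; omega

theorem exists_eq_succ_of_monotone {α : Type*} [Fintype α] {S : ℕ → Finset α} (hS : Monotone S) :
    ∃ m ≤ Fintype.card α, S m = S (m + 1) := by
  by_contra! h
  have key : ∀ m, m ≤ Fintype.card α + 1 → m ≤ (S m).card := by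
    intro m
    induction m with
    | zero => exact fun _ => Nat.zero_le _
    | succ m ih =>
      intro hm
      have := Finset.card_lt_card ((hS (Nat.le_add_right m 1)).lt_of_ne (h m (by omega)))
      have := ih (by omega)
      omega
  have := key _ le_rfl
  have := (S (Fintype.card α + 1)).card_le_univ
  omega

/-- There are `(k + 1) * (k + 1)` pairs of root indices, so the growing sets of pairs below
successive thresholds must repeat. At a repetition no distance lies between a threshold and the
next. -/
theorem RootedPartialKTree.exists_clusters {k : ℕ} (p : ℕ) {V : Type*}
    (G : RootedPartialKTree k V) :
    ∃ D ≤ gapThreshold p ((k + 1) * (k + 1)), ∃ (S : Setoid (Fin (k + 1))),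
      (∀ i j, S i j → G.distType i j ≤ D) ∧
      ∀ i j, ¬S i j → ((2 * D + 4 * p + 3 : ℕ) : ℕ∞) ≤ G.distType i j := by
  classical
  let S : ℕ → Finset (Fin (k + 1) × Fin (k + 1)) := fun m =>
    Finset.univ.filter fun x => G.distType x.1 x.2 ≤ gapThreshold p m
  have hS : Monotone S := fun m m' hm x hx => by
    simp only [S, Finset.mem_filter, Finset.mem_univ, true_and] at hx ⊢
    exact hx.trans (by exact_mod_cast gapThreshold_monotone p hm)
  obtain ⟨m, hm, hmS⟩ := exists_eq_succ_of_monotone hS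
  have hiff : ∀ i j, G.distType i j ≤ gapThreshold p m ↔
      G.distType i j ≤ (2 * gapThreshold p m + 4 * p + 3 : ℕ) := fun i j => by
    simpa [S, gapThreshold] using Finset.ext_iff.1 hmS (i, j)
  refine ⟨gapThreshold p m, gapThreshold_monotone p (by simpa using hm),
    ⟨fun i j => G.distType i j ≤ gapThreshold p m, ?_, ?_, ?_⟩, fun i j h => h, fun i j h => ?_⟩
  · exact fun i => by simp [RootedPartialKTree.distType]
  · intro i j h
    simpa [RootedPartialKTree.distType, SimpleGraph.edist_comm] using h
  -- Transitivity comes from the gap: a distance of at most `2 * D` is below the next threshold,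
  -- hence at most `D`.
  · intro i j l h h'
    rw [hiff]
    calc G.distType i l ≤ G.distType i j + G.distType j l := SimpleGraph.edist_triangle
      _ ≤ (gapThreshold p m : ℕ∞) + gapThreshold p m := add_le_add h h'
      _ ≤ _ := by norm_cast; omega
  · have h' : ¬G.distType i j ≤ gapThreshold p m := h
    rw [hiff] at h'
    exact (not_le.1 h').le

theorem RootedPartialKTree.exists_bounded {k p q : ℕ} (hq : 0 < q) (hpq : 2 * q < p)
    {V : Type*} (G : RootedPartialKTree k V) (hG : G.graph.IsBipartite) :
    ∃ (n : ℕ) (H : RootedPartialKTree k (Fin n)), H.graph.IsBipartite ∧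
      H.extendable p q ⊆ G.extendable p q ∧ TypePrec G.distType H.distType ∧
      ∀ i j, H.distType i j = ⊤ ∨
        H.distType i j ≤ gapThreshold p ((k + 1) * (k + 1)) := by
  obtain ⟨D, hD, S, hnear, hfar⟩ := G.exists_clusters p
  obtain ⟨n, H, hH, hext, heq, htop⟩ := G.exists_separated_clusters hq hpq hG
    (Quotient.mk S) (fun i j h => hnear i j (Quotient.exact h))
    (fun i j h => hfar i j fun h' => h (Quotient.sound h'))
  refine ⟨n, H, hH, hext, ⟨fun i j a b ha hb => ?_, fun i j => ?_⟩, fun i j => ?_⟩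
  all_goals by_cases h : Quotient.mk S i = Quotient.mk S j
  · rw [heq i j h, ha] at hb
    rw [Nat.cast_inj.1 hb]
  · rw [htop i j h] at hb
    exact absurd hb (ENat.top_ne_natCast b)
  · exact (heq i j h).ge
  · rw [htop i j h]; exact le_top
  · right
    rw [heq i j h]
    exact (hnear i j (Quotient.exact h)).trans (by exact_mod_cast hD)
  · exact Or.inl (htop i j h)

theorem finite_setOf_bounded_matrix {ι : Type*} [Finite ι] (D : ℕ) :
    {M : Matrix ι ι ℕ∞ | ∀ i j, M i j = ⊤ ∨ M i j ≤ D}.Finite := by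
  have h : ({⊤} ∪ (fun n : ℕ => (n : ℕ∞)) '' Set.Iic D).Finite :=
    (Set.finite_singleton _).union ((Set.finite_Iic D).image _)
  refine (Set.Finite.pi' fun _ : ι => Set.Finite.pi' fun _ : ι => h).subset fun M hM i j => ?_
  rcases hM i j with h | h
  · exact Or.inl h
  · obtain ⟨n, hn⟩ := ENat.ne_top_iff_exists.1 (ne_top_of_le_ne_top (ENat.natCast_ne_top D) h)
    rw [← hn] at h
    exact Or.inr ⟨n, by exact_mod_cast h, hn⟩

theorem lemma7 (k p q : ℕ) (hq : 0 < q) (hpq : 2 * q < p) :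
    ∃ (m : ℕ) (n : Fin m → ℕ) (H : ∀ i : Fin m, RootedPartialKTree k (Fin (n i))),
      (∀ i, (H i).graph.IsBipartite) ∧
      ∀ (V : Type*) (G : RootedPartialKTree k V), G.graph.IsBipartite →
        ∃ i : Fin m, (H i).extendable p q ⊆ G.extendable p q ∧
          TypePrec G.distType (H i).distType := by
  -- Only the extendable set and the type matter, so the realized pairs are indexed instead of the
  -- graphs.
  let 𝓢 : Set (Set (Fin (k + 1) → Fin p) × Matrix (Fin (k + 1)) (Fin (k + 1)) ℕ∞) :=
    {x | (∀ i j, x.2 i j = ⊤ ∨ x.2 i j ≤ gapThreshold p ((k + 1) * (k + 1))) ∧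
      ∃ (n : ℕ) (H : RootedPartialKTree k (Fin n)), H.graph.IsBipartite ∧
        H.extendable p q = x.1 ∧ H.distType = x.2}
  have hfin : 𝓢.Finite := (Set.finite_univ.prod (finite_setOf_bounded_matrix _)).subset
    fun x hx => ⟨Set.mem_univ _, hx.1⟩
  have := hfin.to_subtype
  obtain ⟨m, ⟨e⟩⟩ := Finite.exists_equiv_fin 𝓢
  choose n H hH hext htype using fun x : 𝓢 => x.2.2
  refine ⟨m, fun i => n (e.symm i), fun i => H (e.symm i), fun i => hH _, fun V G hG => ?_⟩
  obtain ⟨n', H', hH', hsub, hprec, hbd⟩ := G.exists_bounded hq hpq hG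
  let x : 𝓢 := ⟨(H'.extendable p q, H'.distType), hbd, n', H', hH', rfl, rfl⟩
  refine ⟨e x, ?_⟩
  simp only
  rw [e.symm_apply_apply, hext x, htype x]
  exact ⟨hsub, hprec⟩
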